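/- **Predictive distribution of the bivariate MARD model.** Let $p\in\mathbb N$, $x\in\mathbb R^p$, $\beta_*\in\mathbb R^{2p}$, let $M_*\in\mathbb R^{p\times p}$ and $V_*\in\mathbb R^{2\times 2}$ be symmetric positive definite, and let $\nu_*>1$, $c_*>0$, $d_1^*,\dots,d_p^*>0$ be real. Normal densities $\mathrm N(z\mid\mu,\Lambda)$ are parametrized by mean $\mu$ and precision (inverse covariance) matrix $\Lambda$; $\mathrm W(K\mid\nu,V)$ is the density of the Wishart distribution on $2\times2$ matrices with $\nu$ degrees of freedom and scale matrix $V$, i.e. proportional to $|K|^{(\nu-3)/2}e^{-\frac12\mathrm{tr}(V^{-1}K)}$ on positive definite $K=\begin{pmatrix}\tau_a&\kappa\\ \kappa&\tau_v\end{pmatrix}$, with respect to $dK=d\tau_a\,d\kappa\,d\tau_v$; $\mathrm{Gamma}(\alpha\mid c,d)$ has shape $c$ and rate $d$. Let the MARD variational posterior be $$q^*(\beta,K,\alpha)=q^*(\beta,K)\prod_{j=1}^p\mathrm{Gamma}(\alpha_j\mid c_*,d_j^*),\qquad q^*(\beta,K)=\mathrm N(\beta\mid\beta_*,K\otimes M_*)\,\mathrm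 W(K\mid\nu_*,V_*),$$ and let the likelihood of a new response $y\in\mathbb R^2$ at covariate $x$ be $\mathrm N(y\mid B^Tx,K)$, where $B\in\mathbb R^{p\times2}$ and $\beta=\mathrm{vec}(B)$ stacks the columns of $B$. Put $\Xi=I_2\otimes x^T$ and $\varphi=1+x^TM_*^{-1}x$. Then, for every $y\in\mathbb R^2$, the three integrals below converge absolutely and $$\iiint \mathrm N(y\mid B^Tx,K)\,q^*(\beta,K,\alpha)\,d\beta\,dK\,d\alpha=\iint \mathrm N(y\mid B^Tx,K)\,q^*(\beta,K)\,d\beta\,dK=\int \mathrm N(y\mid\Xi\beta_*,\varphi^{-1}K)\,\mathrm W(K\mid\nu_*,V_*)\,dK$$ $$= t\!\left(y\,\Big|\,\nu_*-1,\ \Xi\beta_*,\ \frac{1+x^TM_*^{-1}x}{\nu_*-1}\,V_*^{-1}\right),$$ where $t(y\mid n,\mu,\Sigma)=\dfrac{\Gamma((n+2)/2)}{\Gamma(n/2)\,n\pi\,|\Sigma|^{1/2}}\Big(1+\tfrac1n(y-\mu)^T\Sigma^{-1}(y-\mu)\Big)^{-(n+2)/2}$ is the bivariate Student-$t$ density with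 $n$ degrees of freedom, location $\mu$ and scale matrix $\Sigma$. -/

import Mathlib

open MeasureTheory ProbabilityTheory
open scoped Kronecker

namespace MARD

/-- Density at `z` of the multivariate normal distribution with mean `μ` and **precision**
matrix (inverse covariance) `Λ`, with respect to Lebesgue measure on `ι → ℝ`. -/
noncomputable def normalDensity {ι : Type*} [Fintype ι] [DecidableEq ι]
    (μ : ι → ℝ) (Λ : Matrix ι ι ℝ) (z : ι → ℝ) : ℝ :=
  Real.sqrt Λ.det / (2 * Real.pi) ^ ((Fintype.card ι : ℝ) / 2) *
    Real.exp (-(1 / 2) * ((z - μ) ⬝ᵥ Λ.mulVec (z - μ)))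

/-- The multivariate Gamma function
`Γ_d(a) = π^{d(d-1)/4} ∏_{j=1}^{d} Γ(a + (1 - j)/2)`; the product is indexed from `0` here. -/
noncomputable def multivariateGamma (d : ℕ) (a : ℝ) : ℝ :=
  Real.pi ^ ((d : ℝ) * ((d : ℝ) - 1) / 4) * ∏ j : Fin d, Real.Gamma (a - (j : ℝ) / 2)

/-- Density of the Wishart distribution on `d × d` matrices with `ν` degrees of freedom and
scale matrix `V`, with respect to Lebesgue measure on the entries on and above the diagonal.
It vanishes off the cone of positive definite matrices. -/
noncomputable def wishartDensity {d : ℕ} (ν : ℝ) (V : Matrix (Fin d) (Fin d) ℝ) :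
    Matrix (Fin d) (Fin d) ℝ → ℝ :=
  Set.indicator {K | K.PosDef} fun K =>
    K.det ^ ((ν - d - 1) / 2) * Real.exp (-(1 / 2) * (V⁻¹ * K).trace) /
      (2 ^ (ν * d / 2) * V.det ^ (ν / 2) * multivariateGamma d (ν / 2))

/-- Density at `z` of the multivariate Student t distribution with `ν` degrees of freedom,
location `μ` and scale matrix `S` (so that the covariance is `ν / (ν - 2) • S` for `2 < ν`). -/
noncomputable def studentTDensity {ι : Type*} [Fintype ι] [DecidableEq ι]
    (ν : ℝ) (μ : ι → ℝ) (S : Matrix ι ι ℝ) (z : ι → ℝ) : ℝ :=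
  Real.Gamma ((ν + Fintype.card ι) / 2) /
      (Real.Gamma (ν / 2) * (ν * Real.pi) ^ ((Fintype.card ι : ℝ) / 2) * Real.sqrt S.det) *
    (1 + (1 / ν) * ((z - μ) ⬝ᵥ S⁻¹.mulVec (z - μ))) ^ (-(ν + Fintype.card ι) / 2)

/-- The symmetric matrix `[[τₐ, κ], [κ, τᵥ]]` with coordinates `(τₐ, κ, τᵥ)`. Integrals over
`K` are integrals over these coordinates with respect to Lebesgue measure. -/
def precisionMatrix (k : ℝ × ℝ × ℝ) : Matrix (Fin 2) (Fin 2) ℝ :=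
  !![k.1, k.2.1; k.2.1, k.2.2]

/-- The `p × 2` matrix `B` of regression coefficients with `vec B = β`. -/
def unvec {p : ℕ} (β : Fin 2 × Fin p → ℝ) : Matrix (Fin p) (Fin 2) ℝ :=
  Matrix.of fun j k => β (k, j)

theorem vec_unvec {p : ℕ} (β : Fin 2 × Fin p → ℝ) : (unvec β).vec = β := rfl

/-- The `2 × 2p` matrix `Ξ = I₂ ⊗ xᵀ`. -/
def designMatrix {p : ℕ} (x : Fin p → ℝ) : Matrix (Fin 2) (Fin 2 × Fin p) ℝ :=
  ((1 : Matrix (Fin 2) (Fin 2) ℝ) ⊗ₖ Matrix.replicateRow Unit x).submatrix (fun i => (i, ())) id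

/-- The likelihood `N(y | Bᵀ x, K)` of a response `y` at the covariate `x`, where `β = vec B`. -/
noncomputable def likelihood {p : ℕ} (x : Fin p → ℝ) (β : Fin 2 × Fin p → ℝ)
    (K : Matrix (Fin 2) (Fin 2) ℝ) (y : Fin 2 → ℝ) : ℝ :=
  normalDensity ((unvec β).transpose.mulVec x) K y

/-- The Normal–Wishart factor `q*(β, K) = N(β | β*, K ⊗ M*) W(K | ν*, V*)`. -/
noncomputable def normalWishartFactor {p : ℕ} (βs : Fin 2 × Fin p → ℝ)
    (M : Matrix (Fin p) (Fin p) ℝ) (ν : ℝ) (V : Matrix (Fin 2) (Fin 2) ℝ)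
    (β : Fin 2 × Fin p → ℝ) (K : Matrix (Fin 2) (Fin 2) ℝ) : ℝ :=
  normalDensity βs (K ⊗ₖ M) β * wishartDensity ν V K

/-- The MARD mean-field variational posterior
`q*(β, K, α) = q*(β, K) ∏ⱼ Gamma(αⱼ | c*, dⱼ*)` (shape `c*`, rates `dⱼ*`). -/
noncomputable def variationalPosterior {p : ℕ} (βs : Fin 2 × Fin p → ℝ)
    (M : Matrix (Fin p) (Fin p) ℝ) (ν : ℝ) (V : Matrix (Fin 2) (Fin 2) ℝ)
    (c : ℝ) (d : Fin p → ℝ)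
    (β : Fin 2 × Fin p → ℝ) (K : Matrix (Fin 2) (Fin 2) ℝ) (α : Fin p → ℝ) : ℝ :=
  normalWishartFactor βs M ν V β K * ∏ j, gammaPDFReal c (d j) (α j)

end MARD

/-!
The proof is Bayes' rule with conjugate priors, applied twice, in the form of pointwise identities
between densities. Throughout, `φ = 1 + xᵀ M⁻¹ x`.

For a fixed positive definite `K`, completing the square in `β`
(`likelihood_mul_normalDensity`) writes the likelihood times the normal prior as
`N(y | Ξ βs, φ⁻¹ K)` times the normal density in `β` with precision `K ⊗ (M + x xᵀ)`. The key facts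
are `(M + x xᵀ) (φ⁻¹ M⁻¹ x) = x` and `det (M + x xᵀ) = φ det M`. Since a normal density has integral
one (`lintegral_normalDensity`), integrating out `β` leaves the Wishart mixture of normals.

With `r = y - Ξ βs`, the exponent `-(1 / 2) φ⁻¹ rᵀ K r = -(1 / 2) tr (φ⁻¹ r rᵀ K)` and the factor
`√(det K)` are absorbed by the Wishart density (`normalDensity_mul_wishartDensity`): the product is
the Student density of `y` times a Wishart density with `ν + 1` degrees of freedom and inverse scale
`V⁻¹ + φ⁻¹ r rᵀ`. That the latter has integral one (`lintegral_wishartDensity`) is computed in the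
coordinates `(τₐ, κ, τᵥ - κ² / τₐ)`. The Gamma factors in `α` integrate to one and split off.

All integrals are of nonnegative functions, so they are computed as Lebesgue integrals with values
in `[0, ∞]`, where Tonelli's theorem needs measurability only; a finite value then gives both
integrability and the Bochner integral (`integrable_and_integral_eq_of_lintegral`).
-/

namespace MARD

/-! ### Reduction of Bochner integrals to Lebesgue integrals -/

theorem integrable_and_integral_eq_of_lintegral {α : Type*} [MeasurableSpace α] {μ : Measure α}
    {f : α → ℝ} (hf : Measurable f) (h0 : ∀ a, 0 ≤ f a) {I : ℝ} (hI : 0 ≤ I)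
    (h : ∫⁻ a, ENNReal.ofReal (f a) ∂μ = ENNReal.ofReal I) :
    Integrable f μ ∧ ∫ a, f a ∂μ = I := by
  refine ⟨?_, ?_⟩
  · refine (lintegral_ofReal_ne_top_iff_integrable hf.aestronglyMeasurable
      (Filter.Eventually.of_forall h0)).1 ?_
    rw [h]
    exact ENNReal.ofReal_ne_top
  · rw [integral_eq_lintegral_of_nonneg_ae (Filter.Eventually.of_forall h0)
      hf.aestronglyMeasurable, h, ENNReal.toReal_ofReal hI]

theorem lintegral_ofReal_fintype_prod {ι : Type*} [Fintype ι] {f : ι → ℝ → ℝ}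
    (hf : ∀ i, Integrable (f i)) (h0 : ∀ i t, 0 ≤ f i t) :
    ∫⁻ z : ι → ℝ, ENNReal.ofReal (∏ i, f i (z i)) = ENNReal.ofReal (∏ i, ∫ t, f i t) := by
  rw [← integral_fintype_prod_volume_eq_prod, ofReal_integral_eq_lintegral_ofReal]
  · exact Integrable.fintype_prod hf
  · exact Filter.Eventually.of_forall fun z => Finset.prod_nonneg fun i _ => h0 i (z i)

/-! ### One-dimensional integrals -/

theorem integral_gammaPDFReal {c d : ℝ} (hc : 0 < c) (hd : 0 < d) :
    Integrable (gammaPDFReal c d) ∧ ∫ t, gammaPDFReal c d t = 1 :=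
  integrable_and_integral_eq_of_lintegral (measurable_gammaPDFReal c d)
    (gammaPDFReal_nonneg hc hd) zero_le_one
    (by rw [ENNReal.ofReal_one]; exact lintegral_gammaPDF_eq_one hc hd)

theorem lintegral_prod_gammaPDFReal {ι : Type*} [Fintype ι] {c : ℝ} (hc : 0 < c) {d : ι → ℝ}
    (hd : ∀ i, 0 < d i) :
    ∫⁻ α : ι → ℝ, ENNReal.ofReal (∏ i, gammaPDFReal c (d i) (α i)) = 1 := by
  rw [lintegral_ofReal_fintype_prod (f := fun i => gammaPDFReal c (d i))
    (fun i => (integral_gammaPDFReal hc (hd i)).1) (fun i => gammaPDFReal_nonneg hc (hd i))]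
  simp [(integral_gammaPDFReal hc (hd _)).2]

theorem lintegral_indicator_rpow_mul_exp {a r : ℝ} (ha : 0 < a) (hr : 0 < r) :
    ∫⁻ t, ENNReal.ofReal
        ((Set.Ioi (0 : ℝ)).indicator (fun t => t ^ (a - 1) * Real.exp (-(r * t))) t) =
      ENNReal.ofReal (Real.Gamma a / r ^ a) := by
  have hG := Real.Gamma_pos_of_pos ha
  have hra := Real.rpow_pos_of_pos hr a
  have h : ∀ᵐ t : ℝ, ENNReal.ofReal
        ((Set.Ioi (0 : ℝ)).indicator (fun t => t ^ (a - 1) * Real.exp (-(r * t))) t) =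
      ENNReal.ofReal (Real.Gamma a / r ^ a) * gammaPDF a r t := by
    -- the two densities differ only at the null point `0`
    filter_upwards [Measure.ae_ne volume (0 : ℝ)] with t ht
    rcases lt_or_gt_of_ne ht with h | h
    · rw [gammaPDF_of_neg h, Set.indicator_of_notMem (by simpa using h.le)]
      simp
    · rw [gammaPDF_of_nonneg h.le, Set.indicator_of_mem (by simpa using h),
        ← ENNReal.ofReal_mul (by positivity)]
      congr 1
      field_simp
  rw [lintegral_congr_ae h, lintegral_const_mul' _ _ ENNReal.ofReal_ne_top,
    lintegral_gammaPDF_eq_one ha hr, mul_one]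

theorem lintegral_exp_neg_mul_add_sq {b : ℝ} (hb : 0 < b) (m : ℝ) :
    ∫⁻ t : ℝ, ENNReal.ofReal (Real.exp (-b * (t + m) ^ 2)) =
      ENNReal.ofReal (Real.sqrt (Real.pi / b)) := by
  rw [lintegral_add_right_eq_self (fun t : ℝ => ENNReal.ofReal (Real.exp (-b * t ^ 2))) m,
    ← integral_gaussian b, ofReal_integral_eq_lintegral_ofReal (integrable_exp_neg_mul_sq hb)]
  exact Filter.Eventually.of_forall fun t => (Real.exp_pos _).le

/-! ### The normal density -/

theorem normalDensity_nonneg {ι : Type*} [Fintype ι] [DecidableEq ι]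
    (μ : ι → ℝ) (Λ : Matrix ι ι ℝ) (z : ι → ℝ) : 0 ≤ normalDensity μ Λ z := by
  unfold normalDensity
  positivity

theorem lintegral_comp_mulVec {ι : Type*} [Fintype ι] [DecidableEq ι] {A : Matrix ι ι ℝ}
    (hA : A.det ≠ 0) {f : (ι → ℝ) → ENNReal} (hf : Measurable f) :
    ∫⁻ z, f (A.mulVec z) = ENNReal.ofReal |A.det⁻¹| * ∫⁻ z, f z := by
  have hm : Measurable (Matrix.toLin' A) :=
    (LinearMap.continuous_on_pi (Matrix.toLin' A)).measurable
  have := lintegral_map (μ := volume) hf hm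
  rw [Real.map_matrix_volume_pi_eq_smul_volume_pi hA, lintegral_smul_measure] at this
  simpa using this.symm

/-- With `Λ = Aᵀ A`, the substitution `z ↦ A (z - μ)` reduces the integral to a product of
one-dimensional Gaussian integrals. -/
theorem lintegral_normalDensity {ι : Type*} [Fintype ι] [DecidableEq ι]
    (μ : ι → ℝ) {Λ : Matrix ι ι ℝ} (hΛ : Λ.PosDef) :
    ∫⁻ z, ENNReal.ofReal (normalDensity μ Λ z) = 1 := by
  obtain ⟨A, hA⟩ : ∃ A : Matrix ι ι ℝ, Λ = A.transpose * A := by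
    open scoped MatrixOrder Matrix.Norms.L2Operator in
    obtain ⟨A, hA⟩ := CStarAlgebra.nonneg_iff_eq_star_mul_self.mp hΛ.posSemidef.nonneg
    exact ⟨A, by rw [hA, Matrix.star_eq_conjTranspose, Matrix.conjTranspose_eq_transpose_of_trivial]⟩
  have hdet : Λ.det = A.det ^ 2 := by rw [hA, Matrix.det_mul, Matrix.det_transpose, sq]
  have hA0 : A.det ≠ 0 := by
    intro h
    have := hΛ.det_pos
    rw [hdet, h] at this
    simp at this
  have hq : ∀ z : ι → ℝ, z ⬝ᵥ Λ.mulVec z = ∑ i, (A.mulVec z i) ^ 2 := by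
    intro z
    rw [hA, ← Matrix.mulVec_mulVec, Matrix.dotProduct_mulVec, Matrix.vecMul_transpose]
    simp [dotProduct, sq]
  have hn : ∀ z, ENNReal.ofReal (normalDensity μ Λ z) =
      ENNReal.ofReal (|A.det| / (2 * Real.pi) ^ ((Fintype.card ι : ℝ) / 2)) *
        ENNReal.ofReal (∏ i, Real.exp (-(1 / 2) * (A.mulVec (z - μ) i) ^ 2)) := by
    intro z
    rw [← ENNReal.ofReal_mul (by positivity), normalDensity, hq, hdet, Real.sqrt_sq_eq_abs,
      Finset.mul_sum, Real.exp_sum]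
  simp_rw [hn]
  have hm : Measurable fun z : ι → ℝ =>
      ENNReal.ofReal (∏ i, Real.exp (-(1 / 2) * z i ^ 2)) := by fun_prop
  have hmA : Measurable fun z : ι → ℝ => A.mulVec z :=
    (LinearMap.continuous_on_pi (Matrix.toLin' A)).measurable
  rw [lintegral_const_mul' _ _ ENNReal.ofReal_ne_top,
    lintegral_sub_right_eq_self
      (fun z => ENNReal.ofReal (∏ i, Real.exp (-(1 / 2) * (A.mulVec z i) ^ 2))) μ,
    lintegral_comp_mulVec hA0 hm,
    lintegral_ofReal_fintype_prod (f := fun _ t => Real.exp (-(1 / 2) * t ^ 2))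
      (fun _ => integrable_exp_neg_mul_sq (by norm_num)) (fun _ _ => (Real.exp_pos _).le),
    integral_gaussian, Finset.prod_const, Finset.card_univ,
    ← ENNReal.ofReal_mul (abs_nonneg _), ← ENNReal.ofReal_mul (by positivity),
    ENNReal.ofReal_eq_one]
  have h2 : Real.sqrt (Real.pi / (1 / 2)) ^ Fintype.card ι =
      (2 * Real.pi) ^ ((Fintype.card ι : ℝ) / 2) := by
    rw [show Real.pi / (1 / 2) = 2 * Real.pi by ring, Real.sqrt_eq_rpow, ← Real.rpow_natCast,
      ← Real.rpow_mul (by positivity)]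
    congr 1
    ring
  rw [h2, abs_inv]
  have h3 : 0 < (2 * Real.pi) ^ ((Fintype.card ι : ℝ) / 2) := by positivity
  have h4 : 0 < |A.det| := abs_pos.2 hA0
  field_simp

/-! ### Integrating out the regression coefficients -/

theorem kronecker_dotProduct_mulVec {ι κ : Type*} [Fintype ι] [Fintype κ]
    (K : Matrix ι ι ℝ) (M : Matrix κ κ ℝ) (u : ι × κ → ℝ) :
    u ⬝ᵥ (K ⊗ₖ M).mulVec u =
      ∑ i, ∑ k, K i k * ((fun j => u (i, j)) ⬝ᵥ M.mulVec fun j => u (k, j)) := by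
  simp only [dotProduct, Matrix.mulVec, Fintype.sum_prod_type, Matrix.kroneckerMap_apply,
    Finset.mul_sum]
  refine Finset.sum_congr rfl fun i _ => ?_
  rw [Finset.sum_comm]
  refine Finset.sum_congr rfl fun k _ => Finset.sum_congr rfl fun j _ =>
    Finset.sum_congr rfl fun l _ => ?_
  ring

theorem designMatrix_mulVec {p : ℕ} (x : Fin p → ℝ) (β : Fin 2 × Fin p → ℝ) (i : Fin 2) :
    (designMatrix x).mulVec β i = x ⬝ᵥ fun j => β (i, j) := by
  simp [designMatrix, Matrix.mulVec, dotProduct, Fintype.sum_prod_type, Matrix.one_apply]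

theorem unvec_transpose_mulVec {p : ℕ} (x : Fin p → ℝ) (β : Fin 2 × Fin p → ℝ) :
    (unvec β).transpose.mulVec x = (designMatrix x).mulVec β := by
  ext i
  rw [designMatrix_mulVec]
  simp [unvec, Matrix.mulVec, dotProduct, mul_comm]

theorem one_add_dotProduct_inv_pos {κ : Type*} [Fintype κ] [DecidableEq κ] {M : Matrix κ κ ℝ}
    (hM : M.PosDef) (x : κ → ℝ) : 0 < 1 + x ⬝ᵥ M⁻¹.mulVec x := by
  have := hM.inv.posSemidef.dotProduct_mulVec_nonneg x
  rw [star_trivial] at this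
  linarith

theorem posDef_add_smul_vecMulVec {κ : Type*} [Fintype κ] {M : Matrix κ κ ℝ} (hM : M.PosDef)
    {c : ℝ} (hc : 0 ≤ c) (x : κ → ℝ) : (M + c • Matrix.vecMulVec x x).PosDef := by
  refine hM.add_posSemidef (Matrix.PosSemidef.smul ?_ hc)
  simpa using Matrix.posSemidef_vecMulVec_self_star x

theorem det_add_smul_vecMulVec {κ : Type*} [Fintype κ] [DecidableEq κ] {M : Matrix κ κ ℝ}
    (hM : M.det ≠ 0) (c : ℝ) (x : κ → ℝ) :
    (M + c • Matrix.vecMulVec x x).det = M.det * (1 + c * (x ⬝ᵥ M⁻¹.mulVec x)) := by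
  rw [← Matrix.smul_vecMulVec, Matrix.vecMulVec_eq Unit,
    Matrix.det_add_replicateCol_mul_replicateRow hM.isUnit]
  simp [Matrix.mul_assoc, Matrix.det_unique, Matrix.mul_apply, Matrix.mulVec, dotProduct,
    Finset.mul_sum]

/-- Completing the square in one pair of blocks: the vector `w` solves `(M + x xᵀ) w = x`,
so that the posterior precision block is `M + x xᵀ` and the shift is a multiple of `w`. -/
theorem complete_square_block {κ : Type*} [Fintype κ] [DecidableEq κ] {M : Matrix κ κ ℝ}
    (hM : M.PosDef) (x u v : κ → ℝ) (r s : ℝ) {φ : ℝ} (hφ : φ = 1 + x ⬝ᵥ M⁻¹.mulVec x) :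
    (r - x ⬝ᵥ u) * (s - x ⬝ᵥ v) + u ⬝ᵥ M.mulVec v =
      (u - (r * φ⁻¹) • M⁻¹.mulVec x) ⬝ᵥ
        (M + Matrix.vecMulVec x x).mulVec (v - (s * φ⁻¹) • M⁻¹.mulVec x) + r * s * φ⁻¹ := by
  have hφ0 : φ ≠ 0 := by rw [hφ]; exact (one_add_dotProduct_inv_pos hM x).ne'
  have hT : M.transpose = M := by
    simpa [Matrix.conjTranspose_eq_transpose_of_trivial] using hM.isHermitian.eq
  have h1 : M.mulVec (M⁻¹.mulVec x) = x := by
    rw [Matrix.mulVec_mulVec, Matrix.mul_nonsing_inv _ hM.det_pos.ne'.isUnit, Matrix.one_mulVec]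
  have h2 : ∀ a : κ → ℝ, (M⁻¹.mulVec x) ⬝ᵥ M.mulVec a = x ⬝ᵥ a := by
    intro a
    rw [Matrix.dotProduct_mulVec, ← Matrix.mulVec_transpose, hT, h1]
  have h3 : ∀ a b : κ → ℝ, a ⬝ᵥ (Matrix.vecMulVec x x).mulVec b = (x ⬝ᵥ a) * (x ⬝ᵥ b) := by
    intro a b
    rw [Matrix.vecMulVec_mulVec]
    simp [dotProduct_comm a x, mul_comm]
  have h4 : (M⁻¹.mulVec x) ⬝ᵥ x = φ - 1 := by rw [hφ, dotProduct_comm]; ring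
  have h4' : x ⬝ᵥ (M⁻¹.mulVec x) = φ - 1 := by rw [hφ]; ring
  simp only [Matrix.add_mulVec, Matrix.mulVec_sub, Matrix.mulVec_smul, dotProduct_add,
    dotProduct_sub, sub_dotProduct, smul_dotProduct, dotProduct_smul, h1, h2, h3, h4, h4',
    smul_eq_mul, dotProduct_comm u x]
  field_simp
  ring

/-- Bayes' rule for the coefficients at a fixed precision matrix `K`: likelihood times prior is
marginal density of `y` times a normal density in `β`. -/
theorem likelihood_mul_normalDensity {p : ℕ} (x : Fin p → ℝ) (βs : Fin 2 × Fin p → ℝ)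
    {M : Matrix (Fin p) (Fin p) ℝ} (hM : M.PosDef) {K : Matrix (Fin 2) (Fin 2) ℝ}
    (hK : K.PosDef) (y : Fin 2 → ℝ) (β : Fin 2 × Fin p → ℝ) :
    likelihood x β K y * normalDensity βs (K ⊗ₖ M) β =
      normalDensity ((designMatrix x).mulVec βs) ((1 + x ⬝ᵥ M⁻¹.mulVec x)⁻¹ • K) y *
        normalDensity
          (βs + fun a => ((y - (designMatrix x).mulVec βs) a.1 *
            (1 + x ⬝ᵥ M⁻¹.mulVec x)⁻¹) * M⁻¹.mulVec x a.2)
          (K ⊗ₖ (M + Matrix.vecMulVec x x)) β := by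
  have hφ0 := one_add_dotProduct_inv_pos hM x
  have hdet := det_add_smul_vecMulVec hM.det_pos.ne' 1 x
  rw [one_smul, one_mul] at hdet
  have hKd := hK.det_pos
  have hMd := hM.det_pos
  generalize hφ : 1 + x ⬝ᵥ M⁻¹.mulVec x = φ at *
  -- the determinants match because `det (M + x xᵀ) = φ det M`
  have hc : Real.sqrt K.det * Real.sqrt (K ⊗ₖ M).det =
      Real.sqrt (φ⁻¹ • K).det * Real.sqrt (K ⊗ₖ (M + Matrix.vecMulVec x x)).det := by
    rw [← Real.sqrt_mul hKd.le, ← Real.sqrt_mul (by rw [Matrix.det_smul]; positivity),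
      Matrix.det_kronecker, Matrix.det_kronecker, Matrix.det_smul, hdet, Fintype.card_fin,
      Fintype.card_fin]
    congr 1
    field_simp
  have hq : (y - (designMatrix x).mulVec β) ⬝ᵥ K.mulVec (y - (designMatrix x).mulVec β) +
        (β - βs) ⬝ᵥ (K ⊗ₖ M).mulVec (β - βs) =
      (y - (designMatrix x).mulVec βs) ⬝ᵥ
          (φ⁻¹ • K).mulVec (y - (designMatrix x).mulVec βs) +
        (β - (βs + fun a => ((y - (designMatrix x).mulVec βs) a.1 * φ⁻¹) *
            M⁻¹.mulVec x a.2)) ⬝ᵥ (K ⊗ₖ (M + Matrix.vecMulVec x x)).mulVec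
          (β - (βs + fun a => ((y - (designMatrix x).mulVec βs) a.1 * φ⁻¹) *
            M⁻¹.mulVec x a.2)) := by
    have hb : ∀ i, (y - (designMatrix x).mulVec β) i =
        (y - (designMatrix x).mulVec βs) i - x ⬝ᵥ (fun j => (β - βs) (i, j)) := by
      intro i
      have : (designMatrix x).mulVec (β - βs) i = x ⬝ᵥ (fun j => (β - βs) (i, j)) :=
        designMatrix_mulVec x _ i
      rw [← this, Matrix.mulVec_sub]
      simp
    have hd : ∀ (A : Matrix (Fin 2) (Fin 2) ℝ) (r : Fin 2 → ℝ),
        r ⬝ᵥ A.mulVec r = ∑ i, ∑ k, A i k * (r i * r k) := by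
      intro A r
      simp only [dotProduct, Matrix.mulVec, Finset.mul_sum]
      exact Finset.sum_congr rfl fun i _ => Finset.sum_congr rfl fun k _ => by ring
    rw [hd, hd, kronecker_dotProduct_mulVec, kronecker_dotProduct_mulVec]
    simp only [← Finset.sum_add_distrib]
    refine Finset.sum_congr rfl fun i _ => Finset.sum_congr rfl fun k _ => ?_
    have := complete_square_block hM x (fun j => (β - βs) (i, j)) (fun j => (β - βs) (k, j))
      ((y - (designMatrix x).mulVec βs) i) ((y - (designMatrix x).mulVec βs) k) hφ.symm
    rw [hb i, hb k, ← mul_add, this, Matrix.smul_apply, smul_eq_mul, mul_add, add_comm]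
    congr 1
    · ring
    · congr 2
      · ext j
        simp [sub_sub]
      · congr 1
        ext j
        simp [sub_sub]
  rw [likelihood, unvec_transpose_mulVec]
  simp only [normalDensity]
  have key : ∀ {a b c d D E q₁ q₂ q₃ q₄ : ℝ}, a * b = c * d → q₁ + q₂ = q₃ + q₄ →
      a / D * Real.exp (-(1 / 2) * q₁) * (b / E * Real.exp (-(1 / 2) * q₂)) =
        c / D * Real.exp (-(1 / 2) * q₃) * (d / E * Real.exp (-(1 / 2) * q₄)) := by
    intro a b c d D E q₁ q₂ q₃ q₄ h h'
    rw [mul_mul_mul_comm, mul_mul_mul_comm (c / D), ← Real.exp_add, ← Real.exp_add, ← mul_add,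
      ← mul_add, h', div_mul_div_comm, div_mul_div_comm, h]
  exact key hc hq

theorem lintegral_likelihood_mul_normalDensity {p : ℕ} (x : Fin p → ℝ) (βs : Fin 2 × Fin p → ℝ)
    {M : Matrix (Fin p) (Fin p) ℝ} (hM : M.PosDef) {K : Matrix (Fin 2) (Fin 2) ℝ}
    (hK : K.PosDef) (y : Fin 2 → ℝ) :
    ∫⁻ β, ENNReal.ofReal (likelihood x β K y * normalDensity βs (K ⊗ₖ M) β) =
      ENNReal.ofReal (normalDensity ((designMatrix x).mulVec βs)
        ((1 + x ⬝ᵥ M⁻¹.mulVec x)⁻¹ • K) y) := by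
  have hG : (M + Matrix.vecMulVec x x).PosDef := by
    simpa using posDef_add_smul_vecMulVec hM zero_le_one x
  simp_rw [likelihood_mul_normalDensity x βs hM hK y,
    ENNReal.ofReal_mul (normalDensity_nonneg _ _ _)]
  rw [lintegral_const_mul' _ _ ENNReal.ofReal_ne_top, lintegral_normalDensity _ (hK.kronecker hG),
    mul_one]

/-! ### The bivariate Wishart density -/

theorem posDef_precisionMatrix_iff (k : ℝ × ℝ × ℝ) :
    (precisionMatrix k).PosDef ↔ 0 < k.1 ∧ k.2.1 ^ 2 < k.1 * k.2.2 := by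
  constructor
  · intro h
    have h1 := h.diag_pos (i := 0)
    have h2 := h.det_pos
    simp only [precisionMatrix, Matrix.det_fin_two_of, Matrix.of_apply, Matrix.cons_val_zero] at h1 h2
    exact ⟨h1, by nlinarith⟩
  · rintro ⟨h1, h2⟩
    refine Matrix.PosDef.of_dotProduct_mulVec_pos ?_ ?_
    · ext i j
      fin_cases i <;> fin_cases j <;> simp [precisionMatrix]
    · intro u hu
      have e : star u ⬝ᵥ (precisionMatrix k).mulVec u =
          k.1 * u 0 ^ 2 + 2 * k.2.1 * u 0 * u 1 + k.2.2 * u 1 ^ 2 := by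
        simp [precisionMatrix, Matrix.mulVec, dotProduct, Fin.sum_univ_two]
        ring
      rw [e]
      have e2 : k.1 * (k.1 * u 0 ^ 2 + 2 * k.2.1 * u 0 * u 1 + k.2.2 * u 1 ^ 2) =
          (k.1 * u 0 + k.2.1 * u 1) ^ 2 + (k.1 * k.2.2 - k.2.1 ^ 2) * u 1 ^ 2 := by ring
      -- multiplying by `k.1 > 0` turns the quadratic form into a sum of squares
      refine pos_of_mul_pos_right (a := k.1) ?_ h1.le
      rw [e2]
      by_cases h : u 1 = 0
      · have h0 : u 0 ≠ 0 := by
          intro h0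
          exact hu (by ext i; fin_cases i <;> simp [h, h0])
        rw [h]
        have : 0 < (k.1 * u 0) ^ 2 := by positivity
        nlinarith
      · have : 0 < k.1 * k.2.2 - k.2.1 ^ 2 := by linarith
        positivity

theorem measurableSet_posDef_precisionMatrix :
    MeasurableSet {k : ℝ × ℝ × ℝ | (precisionMatrix k).PosDef} := by
  simp_rw [posDef_precisionMatrix_iff]
  have h1 : Measurable fun k : ℝ × ℝ × ℝ => k.2.1 ^ 2 := by fun_prop
  have h2 : Measurable fun k : ℝ × ℝ × ℝ => k.1 * k.2.2 := by fun_prop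
  exact (measurableSet_lt measurable_const measurable_fst).inter (measurableSet_lt h1 h2)

theorem measurable_precisionMatrix_apply (i j : Fin 2) :
    Measurable fun k => precisionMatrix k i j := by
  fin_cases i <;> fin_cases j <;> simp [precisionMatrix] <;> fun_prop

theorem multivariateGamma_pos {d : ℕ} {a : ℝ} (ha : (d : ℝ) - 1 < 2 * a) :
    0 < multivariateGamma d a := by
  refine mul_pos (by positivity) (Finset.prod_pos fun j _ => Real.Gamma_pos_of_pos ?_)
  have : (j : ℝ) + 1 ≤ d := by exact_mod_cast j.2
  linarith

theorem multivariateGamma_two (a : ℝ) :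
    multivariateGamma 2 a = Real.sqrt Real.pi * (Real.Gamma a * Real.Gamma (a - 1 / 2)) := by
  rw [multivariateGamma, Fin.prod_univ_two, Real.sqrt_eq_rpow]
  norm_num

theorem wishartDensity_nonneg {d : ℕ} {ν : ℝ} (hν : (d : ℝ) - 1 < ν)
    {V : Matrix (Fin d) (Fin d) ℝ} (hV : V.PosDef) (K : Matrix (Fin d) (Fin d) ℝ) :
    0 ≤ wishartDensity ν V K := by
  refine Set.indicator_nonneg (fun K (hK : K.PosDef) => ?_) K
  have h1 := hK.det_pos
  have h2 := hV.det_pos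
  have h3 : 0 < multivariateGamma d (ν / 2) := multivariateGamma_pos (by linarith)
  positivity

theorem wishartDensity_of_posDef {d : ℕ} (ν : ℝ) (V : Matrix (Fin d) (Fin d) ℝ)
    {K : Matrix (Fin d) (Fin d) ℝ} (hK : K.PosDef) :
    wishartDensity ν V K = K.det ^ ((ν - d - 1) / 2) * Real.exp (-(1 / 2) * (V⁻¹ * K).trace) /
      (2 ^ (ν * d / 2) * V.det ^ (ν / 2) * multivariateGamma d (ν / 2)) :=
  Set.indicator_of_mem (s := {K : Matrix (Fin d) (Fin d) ℝ | K.PosDef}) hK _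

theorem wishartDensity_of_not_posDef {d : ℕ} (ν : ℝ) (V : Matrix (Fin d) (Fin d) ℝ)
    {K : Matrix (Fin d) (Fin d) ℝ} (hK : ¬ K.PosDef) : wishartDensity ν V K = 0 :=
  Set.indicator_of_notMem (s := {K : Matrix (Fin d) (Fin d) ℝ | K.PosDef}) hK _

theorem measurable_wishartDensity_precisionMatrix (ν : ℝ) (V : Matrix (Fin 2) (Fin 2) ℝ) :
    Measurable fun k => wishartDensity ν V (precisionMatrix k) := by
  have : (fun k => wishartDensity ν V (precisionMatrix k)) =
      {k : ℝ × ℝ × ℝ | (precisionMatrix k).PosDef}.indicator fun k =>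
        (precisionMatrix k).det ^ ((ν - (2 : ℕ) - 1) / 2) *
          Real.exp (-(1 / 2) * (V⁻¹ * precisionMatrix k).trace) /
        (2 ^ (ν * (2 : ℕ) / 2) * V.det ^ (ν / 2) * multivariateGamma 2 (ν / 2)) := by
    ext k
    by_cases h : (precisionMatrix k).PosDef
    · rw [wishartDensity_of_posDef ν V h, Set.indicator_of_mem (by simpa using h)]
    · rw [wishartDensity_of_not_posDef ν V h, Set.indicator_of_notMem (by simpa using h)]
  rw [this]
  refine Measurable.indicator ?_ measurableSet_posDef_precisionMatrix
  have hm := measurable_precisionMatrix_apply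
  simp only [Matrix.det_fin_two, Matrix.trace_fin_two, Matrix.mul_apply, Fin.sum_univ_two]
  fun_prop

/-- Along the Schur complement `s = τᵥ - κ² / τₐ` the unnormalised Wishart density factors into
a function of `τₐ`, a Gaussian factor in `κ` and a function of `s`. -/
theorem indicator_posDef_schur (m w₁ w₂ w₃ : ℝ) (hw : 0 < w₃) (a b s : ℝ) :
    ({k : ℝ × ℝ × ℝ | (precisionMatrix k).PosDef}.indicator
        (fun k => (precisionMatrix k).det ^ m *
          Real.exp (-(1 / 2) * (!![w₁, w₂; w₂, w₃] * precisionMatrix k).trace))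
        (a, b, s + b ^ 2 / a)) =
      (Set.Ioi (0 : ℝ)).indicator
          (fun a => a ^ m * Real.exp (-((w₁ * w₃ - w₂ ^ 2) / (2 * w₃) * a))) a *
        (Real.exp (-(w₃ / (2 * a)) * (b + w₂ * a / w₃) ^ 2) *
          (Set.Ioi (0 : ℝ)).indicator (fun s => s ^ m * Real.exp (-(w₃ / 2 * s))) s) := by
  by_cases ha : 0 < a
  · by_cases hs : 0 < s
    · rw [Set.indicator_of_mem (a := a) (by simpa using ha),
        Set.indicator_of_mem (a := s) (by simpa using hs), Set.indicator_of_mem]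
      · have hdet : (precisionMatrix (a, b, s + b ^ 2 / a)).det = a * s := by
          simp only [precisionMatrix, Matrix.det_fin_two_of]
          field_simp
          ring
        rw [hdet, Real.mul_rpow ha.le hs.le]
        have e : Real.exp (-(1 / 2) *
              (!![w₁, w₂; w₂, w₃] * precisionMatrix (a, b, s + b ^ 2 / a)).trace) =
            Real.exp (-((w₁ * w₃ - w₂ ^ 2) / (2 * w₃) * a)) *
              (Real.exp (-(w₃ / (2 * a)) * (b + w₂ * a / w₃) ^ 2) *
                Real.exp (-(w₃ / 2 * s))) := by
          rw [← Real.exp_add, ← Real.exp_add]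
          congr 1
          simp only [precisionMatrix, Matrix.trace_fin_two, Matrix.mul_apply, Fin.sum_univ_two,
            Matrix.of_apply, Matrix.cons_val_zero, Matrix.cons_val_one, Matrix.cons_val',
            Matrix.cons_val_fin_one]
          field_simp
          ring
        rw [e]
        ring
      · refine (posDef_precisionMatrix_iff (a, b, s + b ^ 2 / a)).2 ⟨ha, ?_⟩
        have : a * (s + b ^ 2 / a) = a * s + b ^ 2 := by field_simp
        have := mul_pos ha hs
        simp only
        linarith
    · rw [Set.indicator_of_notMem (a := s) (by simpa using hs), Set.indicator_of_notMem]
      · simp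
      · intro h
        have h2 := ((posDef_precisionMatrix_iff _).1 h).2
        have : a * (s + b ^ 2 / a) = a * s + b ^ 2 := by field_simp
        simp only [this] at h2
        exact hs (pos_of_mul_pos_right (by linarith : 0 < a * s) ha.le)
  · rw [Set.indicator_of_notMem (a := a) (by simpa using ha), Set.indicator_of_notMem, zero_mul]
    exact fun h => ha ((posDef_precisionMatrix_iff _).1 h).1

/-- The bivariate Wishart normalising constant. The Schur complement coordinate
`s = τᵥ - κ² / τₐ` separates the variables: `s` contributes a Gamma integral, `κ` a Gaussian
integral of value proportional to `√τₐ`, and `τₐ` then a second Gamma integral. -/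
theorem lintegral_indicator_posDef {n w₁ w₂ w₃ : ℝ} (hn : 1 < n) (hw : 0 < w₃)
    (hd : 0 < w₁ * w₃ - w₂ ^ 2) :
    ∫⁻ k, ENNReal.ofReal ({k : ℝ × ℝ × ℝ | (precisionMatrix k).PosDef}.indicator
        (fun k => (precisionMatrix k).det ^ ((n - 3) / 2) *
          Real.exp (-(1 / 2) * (!![w₁, w₂; w₂, w₃] * precisionMatrix k).trace)) k) =
      ENNReal.ofReal (2 ^ n * (w₁ * w₃ - w₂ ^ 2) ^ (-(n / 2)) *
        multivariateGamma 2 (n / 2)) := by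
  set m : ℝ := (n - 3) / 2 with hm
  set F : ℝ × ℝ × ℝ → ℝ := {k : ℝ × ℝ × ℝ | (precisionMatrix k).PosDef}.indicator
        (fun k => (precisionMatrix k).det ^ m *
          Real.exp (-(1 / 2) * (!![w₁, w₂; w₂, w₃] * precisionMatrix k).trace)) with hF
  have hFm : Measurable F := by
    refine Measurable.indicator ?_ measurableSet_posDef_precisionMatrix
    have hm := measurable_precisionMatrix_apply
    simp only [Matrix.det_fin_two, Matrix.trace_fin_two, Matrix.mul_apply, Fin.sum_univ_two]
    fun_prop
  set δ : ℝ := (w₁ * w₃ - w₂ ^ 2) / (2 * w₃) with hδ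
  have hδ0 : 0 < δ := by positivity
  have h3 : ∫⁻ s, ENNReal.ofReal ((Set.Ioi (0 : ℝ)).indicator
      (fun s => s ^ m * Real.exp (-(w₃ / 2 * s))) s) =
        ENNReal.ofReal (Real.Gamma ((n - 1) / 2) / (w₃ / 2) ^ ((n - 1) / 2)) := by
    rw [← lintegral_indicator_rpow_mul_exp (by linarith) (by positivity)]
    rw [show (n - 1) / 2 - 1 = m by rw [hm]; ring]
  have hG3 : 0 < Real.Gamma ((n - 1) / 2) := Real.Gamma_pos_of_pos (by linarith)
  have hG1 : 0 < Real.Gamma (n / 2) := Real.Gamma_pos_of_pos (by linarith)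
  set C : ℝ := Real.Gamma ((n - 1) / 2) / (w₃ / 2) ^ ((n - 1) / 2) with hC
  have hC0 : 0 < C := by positivity
  have hin : ∀ a, ∫⁻ q : ℝ × ℝ, ENNReal.ofReal (F (a, q)) =
      ENNReal.ofReal (C * Real.sqrt (2 * Real.pi / w₃)) *
        ENNReal.ofReal ((Set.Ioi (0 : ℝ)).indicator
          (fun a => a ^ (n / 2 - 1) * Real.exp (-(δ * a))) a) := by
    intro a
    rw [Measure.volume_eq_prod, lintegral_prod _ (by fun_prop)]
    have hs : ∀ b, ∫⁻ c, ENNReal.ofReal (F (a, b, c)) =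
        ENNReal.ofReal ((Set.Ioi (0 : ℝ)).indicator
          (fun a => a ^ m * Real.exp (-(δ * a))) a) *
        (ENNReal.ofReal (Real.exp (-(w₃ / (2 * a)) * (b + w₂ * a / w₃) ^ 2)) *
          ENNReal.ofReal C) := by
      intro b
      -- translating `τᵥ` by `b ^ 2 / a` makes the Schur complement the integration variable
      rw [← lintegral_add_right_eq_self _ (b ^ 2 / a)]
      have h0 : 0 ≤ (Set.Ioi (0 : ℝ)).indicator (fun a => a ^ m * Real.exp (-(δ * a))) a :=
        Set.indicator_nonneg
          (fun t (ht : 0 < t) => mul_nonneg (Real.rpow_nonneg ht.le _) (Real.exp_pos _).le) a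
      have hp : ∀ s, ENNReal.ofReal (F (a, b, s + b ^ 2 / a)) = _ := fun s => by
        rw [hF, indicator_posDef_schur m w₁ w₂ w₃ hw a b s, ENNReal.ofReal_mul h0,
          ENNReal.ofReal_mul (Real.exp_pos _).le]
      simp_rw [hp]
      rw [lintegral_const_mul' _ _ ENNReal.ofReal_ne_top,
        lintegral_const_mul' _ _ ENNReal.ofReal_ne_top, h3]
    simp_rw [hs]
    rw [lintegral_const_mul' _ _ ENNReal.ofReal_ne_top,
      lintegral_mul_const' _ _ ENNReal.ofReal_ne_top]
    by_cases ha : 0 < a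
    · rw [lintegral_exp_neg_mul_add_sq (by positivity),
        Set.indicator_of_mem (by simpa using ha), Set.indicator_of_mem (by simpa using ha),
        ← ENNReal.ofReal_mul (by positivity), ← ENNReal.ofReal_mul (by positivity),
        ← ENNReal.ofReal_mul (by positivity)]
      congr 1
      have e1 : Real.sqrt (Real.pi / (w₃ / (2 * a))) =
          Real.sqrt (2 * Real.pi / w₃) * a ^ (1 / 2 : ℝ) := by
        rw [← Real.sqrt_eq_rpow, ← Real.sqrt_mul (by positivity)]
        congr 1
        field_simp
      have e2 : a ^ (n / 2 - 1) = a ^ m * a ^ (1 / 2 : ℝ) := by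
        rw [← Real.rpow_add ha]
        congr 1
        rw [hm]
        ring
      rw [e1, e2]
      ring
    · rw [Set.indicator_of_notMem (by simpa using ha), Set.indicator_of_notMem (by simpa using ha)]
      simp
  rw [Measure.volume_eq_prod, lintegral_prod _ (by fun_prop)]
  simp_rw [hin]
  rw [lintegral_const_mul' _ _ ENNReal.ofReal_ne_top,
    lintegral_indicator_rpow_mul_exp (by linarith) hδ0, ← ENNReal.ofReal_mul (by positivity)]
  congr 1
  have e3 : (2 : ℝ) ^ n = 2 ^ ((n - 1) / 2) * 2 ^ (1 / 2 : ℝ) * 2 ^ (n / 2) := by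
    rw [← Real.rpow_add two_pos, ← Real.rpow_add two_pos]
    congr 1
    ring
  have e4 : w₃ ^ (n / 2) = w₃ ^ ((n - 1) / 2) * w₃ ^ (1 / 2 : ℝ) := by
    rw [← Real.rpow_add hw]
    congr 1
    ring
  rw [multivariateGamma_two, show n / 2 - 1 / 2 = (n - 1) / 2 by ring, e3, hC, hδ,
    Real.sqrt_div (by positivity), Real.sqrt_mul two_pos.le,
    Real.div_rpow hd.le (by positivity), Real.div_rpow hw.le two_pos.le,
    Real.mul_rpow two_pos.le hw.le, Real.rpow_neg hd.le, e4, Real.sqrt_eq_rpow 2,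
    Real.sqrt_eq_rpow w₃]
  have := Real.rpow_pos_of_pos hd (n / 2)
  field_simp

theorem lintegral_wishartDensity {ν : ℝ} (hν : 1 < ν) {V : Matrix (Fin 2) (Fin 2) ℝ}
    (hV : V.PosDef) :
    ∫⁻ k, ENNReal.ofReal (wishartDensity ν V (precisionMatrix k)) = 1 := by
  obtain ⟨w₁, w₂, w₃, hW⟩ : ∃ w₁ w₂ w₃, V⁻¹ = !![w₁, w₂; w₂, w₃] := by
    refine ⟨V⁻¹ 0 0, V⁻¹ 0 1, V⁻¹ 1 1, (Matrix.eta_fin_two _).trans ?_⟩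
    have h := hV.inv.isHermitian.apply 0 1
    rw [star_trivial] at h
    rw [h]
  have hP := hV.inv
  have hVd := hV.det_pos
  rw [hW] at hP
  have hd : w₁ * w₃ - w₂ ^ 2 = V.det⁻¹ := by
    rw [← Ring.inverse_eq_inv', ← Matrix.det_nonsing_inv, hW, Matrix.det_fin_two_of, sq]
  have hw : 0 < w₃ := by simpa using hP.diag_pos (i := 1)
  have hΓ : 0 < multivariateGamma 2 (ν / 2) := multivariateGamma_pos (by push_cast; linarith)
  have e : ∀ k, ENNReal.ofReal (wishartDensity ν V (precisionMatrix k)) =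
      ENNReal.ofReal (2 ^ ν * V.det ^ (ν / 2) * multivariateGamma 2 (ν / 2))⁻¹ *
        ENNReal.ofReal ({k : ℝ × ℝ × ℝ | (precisionMatrix k).PosDef}.indicator
        (fun k => (precisionMatrix k).det ^ ((ν - 3) / 2) *
          Real.exp (-(1 / 2) * (!![w₁, w₂; w₂, w₃] * precisionMatrix k).trace)) k) := by
    intro k
    rw [← ENNReal.ofReal_mul (by positivity)]
    congr 1
    by_cases h : (precisionMatrix k).PosDef
    · rw [wishartDensity_of_posDef ν V h, Set.indicator_of_mem (by simpa using h), hW,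
        div_eq_inv_mul]
      congr 3
      · push_cast; ring_nf
      · push_cast; ring_nf
    · rw [wishartDensity_of_not_posDef ν V h, Set.indicator_of_notMem (by simpa using h), mul_zero]
  simp_rw [e]
  rw [lintegral_const_mul' _ _ ENNReal.ofReal_ne_top,
    lintegral_indicator_posDef hν hw (by rw [hd]; positivity), hd,
    ← ENNReal.ofReal_mul (by positivity), ENNReal.ofReal_eq_one, Real.inv_rpow hVd.le,
    Real.rpow_neg hVd.le, inv_inv]
  have := Real.rpow_pos_of_pos hVd (ν / 2)
  field_simp

/-! ### Integrating out the precision matrix -/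

theorem studentTDensity_nonneg {ι : Type*} [Fintype ι] [DecidableEq ι] {n : ℝ} (hn : 0 < n)
    (μ : ι → ℝ) {S : Matrix ι ι ℝ} (hS : S.PosDef) (z : ι → ℝ) :
    0 ≤ studentTDensity n μ S z := by
  have hq := hS.inv.posSemidef.dotProduct_mulVec_nonneg (z - μ)
  rw [star_trivial] at hq
  have h1 : 0 < Real.Gamma ((n + Fintype.card ι) / 2) := Real.Gamma_pos_of_pos (by positivity)
  have h2 : 0 < Real.Gamma (n / 2) := Real.Gamma_pos_of_pos (by positivity)
  unfold studentTDensity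
  positivity

/-- The Student density with `ν - 1` degrees of freedom and scale matrix `φ / (ν - 1) • V⁻¹`,
with the factors `ν - 1` cancelled. -/
theorem studentTDensity_smul_inv {ν : ℝ} (hν : 1 < ν) {V : Matrix (Fin 2) (Fin 2) ℝ}
    (hV : V.PosDef) {φ : ℝ} (hφ : 0 < φ) (m y : Fin 2 → ℝ) :
    studentTDensity (ν - 1) m ((φ / (ν - 1)) • V⁻¹) y =
      Real.Gamma ((ν + 1) / 2) / Real.Gamma ((ν - 1) / 2) *
        (Real.sqrt V.det / (Real.pi * φ)) *
        (1 + φ⁻¹ * ((y - m) ⬝ᵥ V.mulVec (y - m))) ^ (-((ν + 1) / 2)) := by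
  have hn : 0 < ν - 1 := by linarith
  have hVd := hV.det_pos
  have hinv : ((φ / (ν - 1)) • V⁻¹)⁻¹ = ((ν - 1) / φ) • V := by
    refine Matrix.inv_eq_left_inv ?_
    rw [Matrix.smul_mul, Matrix.mul_smul, Matrix.mul_nonsing_inv _ hVd.ne'.isUnit, smul_smul,
      div_mul_div_cancel₀ hφ.ne', div_self hn.ne', one_smul]
  have hdet : Real.sqrt ((φ / (ν - 1)) • V⁻¹).det = φ / (ν - 1) / Real.sqrt V.det := by
    rw [Matrix.det_smul, Matrix.det_nonsing_inv, Ring.inverse_eq_inv', Fintype.card_fin,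
      ← div_eq_mul_inv, Real.sqrt_div (by positivity), Real.sqrt_sq (by positivity)]
  have hs : 0 < Real.sqrt V.det := Real.sqrt_pos.2 hVd
  have e1 : (ν - 1 + ((2 : ℕ) : ℝ)) = ν + 1 := by push_cast; ring
  have e2 : 1 / (ν - 1) * ((ν - 1) / φ * ((y - m) ⬝ᵥ V.mulVec (y - m))) =
      φ⁻¹ * ((y - m) ⬝ᵥ V.mulVec (y - m)) := by field_simp
  rw [studentTDensity, hinv, hdet, Fintype.card_fin, e1, Matrix.smul_mulVec, dotProduct_smul,
    smul_eq_mul, e2, neg_div]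
  congr 1
  have e3 : ((ν - 1) * Real.pi) ^ (((2 : ℕ) : ℝ) / 2) = (ν - 1) * Real.pi := by norm_num
  rw [e3]
  have hG : 0 < Real.Gamma ((ν - 1) / 2) := Real.Gamma_pos_of_pos (by positivity)
  field_simp

theorem trace_vecMulVec_mul {ι : Type*} [Fintype ι] (r : ι → ℝ) (K : Matrix ι ι ℝ) :
    (Matrix.vecMulVec r r * K).trace = r ⬝ᵥ K.mulVec r := by
  rw [Matrix.vecMulVec_mul, Matrix.trace_vecMulVec, Matrix.dotProduct_mulVec, dotProduct_comm]

/-- Bayes' rule for the precision matrix: the normal likelihood times the Wishart prior is the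
Student density of `y` times a Wishart density with one more degree of freedom. -/
theorem normalDensity_mul_wishartDensity {ν : ℝ} (hν : 1 < ν) {V : Matrix (Fin 2) (Fin 2) ℝ}
    (hV : V.PosDef) {φ : ℝ} (hφ : 0 < φ) (m y : Fin 2 → ℝ) (K : Matrix (Fin 2) (Fin 2) ℝ) :
    normalDensity m (φ⁻¹ • K) y * wishartDensity ν V K =
      studentTDensity (ν - 1) m ((φ / (ν - 1)) • V⁻¹) y *
        wishartDensity (ν + 1) (V⁻¹ + φ⁻¹ • Matrix.vecMulVec (y - m) (y - m))⁻¹ K := by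
  by_cases hK : K.PosDef
  swap
  · simp [wishartDensity_of_not_posDef _ _ hK]
  rw [studentTDensity_smul_inv hν hV hφ]
  generalize hr : y - m = r
  have hW := posDef_add_smul_vecMulVec hV.inv (inv_nonneg.2 hφ.le) r
  have hVd := hV.det_pos
  have hKd := hK.det_pos
  have hWd := hW.det_pos
  have hdet := det_add_smul_vecMulVec hV.inv.det_pos.ne' φ⁻¹ r
  rw [Matrix.nonsing_inv_nonsing_inv _ hVd.ne'.isUnit, Matrix.det_nonsing_inv,
    Ring.inverse_eq_inv'] at hdet
  have hq : 0 < 1 + φ⁻¹ * (r ⬝ᵥ V.mulVec r) := by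
    have := hV.posSemidef.dotProduct_mulVec_nonneg r
    rw [star_trivial] at this
    positivity
  rw [wishartDensity_of_posDef _ _ hK, wishartDensity_of_posDef _ _ hK, normalDensity, hr,
    Matrix.nonsing_inv_nonsing_inv _ hWd.ne'.isUnit, Matrix.det_nonsing_inv,
    Ring.inverse_eq_inv', hdet, Matrix.add_mul, Matrix.trace_add, Matrix.smul_mul,
    Matrix.trace_smul, trace_vecMulVec_mul, Matrix.smul_mulVec, dotProduct_smul, mul_add,
    Real.exp_add, Matrix.det_smul, multivariateGamma_two, multivariateGamma_two]
  generalize 1 + φ⁻¹ * (r ⬝ᵥ V.mulVec r) = Q at *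
  have e1 : K.det ^ ((ν + 1 - (2 : ℕ) - 1) / 2) =
      Real.sqrt K.det * K.det ^ ((ν - (2 : ℕ) - 1) / 2) := by
    rw [Real.sqrt_eq_rpow, ← Real.rpow_add hKd]
    congr 1
    ring
  have e2 : (2 : ℝ) ^ ((ν + 1) * (2 : ℕ) / 2) = 2 * 2 ^ (ν * (2 : ℕ) / 2) := by
    rw [show (ν + 1) * (2 : ℕ) / 2 = 1 + ν * (2 : ℕ) / 2 by push_cast; ring,
      Real.rpow_add two_pos, Real.rpow_one]
  have e3 : (V.det⁻¹ * Q)⁻¹ ^ ((ν + 1) / 2) =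
      Real.sqrt V.det * V.det ^ (ν / 2) * Q ^ (-((ν + 1) / 2)) := by
    rw [mul_inv, inv_inv, Real.mul_rpow hVd.le (by positivity), Real.inv_rpow hq.le,
      Real.rpow_neg hq.le, Real.sqrt_eq_rpow, ← Real.rpow_add hVd]
    congr 2
    ring
  have e4 : Real.sqrt (φ⁻¹ ^ Fintype.card (Fin 2) * K.det) = φ⁻¹ * Real.sqrt K.det := by
    rw [Fintype.card_fin, Real.sqrt_mul (by positivity), Real.sqrt_sq (by positivity)]
  have e5 : (2 * Real.pi) ^ ((Fintype.card (Fin 2) : ℝ) / 2) = 2 * Real.pi := by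
    rw [Fintype.card_fin]
    norm_num
  rw [e1, e2, e3, e4, e5, show (ν + 1) / 2 - 1 / 2 = ν / 2 by ring,
    show ν / 2 - 1 / 2 = (ν - 1) / 2 by ring]
  have g1 : 0 < Real.Gamma ((ν + 1) / 2) := Real.Gamma_pos_of_pos (by linarith)
  have g2 : 0 < Real.Gamma ((ν - 1) / 2) := Real.Gamma_pos_of_pos (by linarith)
  have g3 : 0 < Real.Gamma (ν / 2) := Real.Gamma_pos_of_pos (by linarith)
  have p1 : 0 < Q ^ (-((ν + 1) / 2)) := Real.rpow_pos_of_pos hq _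
  have p2 : 0 < Real.sqrt V.det := Real.sqrt_pos.2 hVd
  have p3 := Real.rpow_pos_of_pos hVd (ν / 2)
  generalize Q ^ (-((ν + 1) / 2)) = q at *
  simp only [smul_eq_mul]
  field_simp

theorem lintegral_normalDensity_mul_wishartDensity {ν : ℝ} (hν : 1 < ν)
    {V : Matrix (Fin 2) (Fin 2) ℝ} (hV : V.PosDef) {φ : ℝ} (hφ : 0 < φ) (m y : Fin 2 → ℝ) :
    ∫⁻ k, ENNReal.ofReal (normalDensity m (φ⁻¹ • precisionMatrix k) y *
        wishartDensity ν V (precisionMatrix k)) =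
      ENNReal.ofReal (studentTDensity (ν - 1) m ((φ / (ν - 1)) • V⁻¹) y) := by
  have hn : 0 < ν - 1 := by linarith
  have ht := studentTDensity_nonneg hn m (hV.inv.smul (div_pos hφ hn)) y
  have hW := posDef_add_smul_vecMulVec hV.inv (inv_nonneg.2 hφ.le) (y - m)
  simp_rw [normalDensity_mul_wishartDensity hν hV hφ, ENNReal.ofReal_mul ht]
  rw [lintegral_const_mul' _ _ ENNReal.ofReal_ne_top,
    lintegral_wishartDensity (by linarith) hW.inv, mul_one]

/-! ### Joint measurability of the densities -/

theorem measurable_normalDensity {ι Ω : Type*} [Fintype ι] [DecidableEq ι] [MeasurableSpace Ω]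
    {μ z : Ω → ι → ℝ} {Λ : Ω → Matrix ι ι ℝ} (hμ : Measurable μ) (hz : Measurable z)
    (hΛ : ∀ i j, Measurable fun ω => Λ ω i j) :
    Measurable fun ω => normalDensity (μ ω) (Λ ω) (z ω) := by
  have hd : Measurable fun ω => (Λ ω).det := by
    simp only [Matrix.det_apply']
    fun_prop
  simp only [normalDensity, dotProduct, Matrix.mulVec, Pi.sub_apply]
  fun_prop

theorem measurable_likelihood {p : ℕ} (x : Fin p → ℝ) (y : Fin 2 → ℝ) :
    Measurable fun θ : (Fin 2 × Fin p → ℝ) × (ℝ × ℝ × ℝ) =>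
      likelihood x θ.1 (precisionMatrix θ.2) y := by
  have h : Measurable fun θ : (Fin 2 × Fin p → ℝ) × (ℝ × ℝ × ℝ) =>
      (unvec θ.1).transpose.mulVec x := by
    refine measurable_pi_lambda _ fun i => ?_
    simp only [Matrix.mulVec, dotProduct, Matrix.transpose_apply, unvec, Matrix.of_apply]
    fun_prop
  exact measurable_normalDensity h measurable_const
    fun i j => (measurable_precisionMatrix_apply i j).comp measurable_snd

theorem measurable_normalWishartFactor {p : ℕ} (βs : Fin 2 × Fin p → ℝ)
    (M : Matrix (Fin p) (Fin p) ℝ) (ν : ℝ) (V : Matrix (Fin 2) (Fin 2) ℝ) :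
    Measurable fun θ : (Fin 2 × Fin p → ℝ) × (ℝ × ℝ × ℝ) =>
      normalWishartFactor βs M ν V θ.1 (precisionMatrix θ.2) := by
  refine (measurable_normalDensity measurable_const measurable_fst fun i j => ?_).mul
    ((measurable_wishartDensity_precisionMatrix ν V).comp measurable_snd)
  exact ((measurable_precisionMatrix_apply i.1 j.1).comp measurable_snd).mul_const _

theorem normalWishartFactor_nonneg {p : ℕ} (βs : Fin 2 × Fin p → ℝ)
    (M : Matrix (Fin p) (Fin p) ℝ) {ν : ℝ} (hν : 1 < ν) {V : Matrix (Fin 2) (Fin 2) ℝ}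
    (hV : V.PosDef) (β : Fin 2 × Fin p → ℝ) (K : Matrix (Fin 2) (Fin 2) ℝ) :
    0 ≤ normalWishartFactor βs M ν V β K :=
  mul_nonneg (normalDensity_nonneg _ _ _) (wishartDensity_nonneg (by push_cast; linarith) hV K)

/-! ### The predictive distribution -/

theorem lintegral_likelihood_mul_normalWishartFactor {p : ℕ} (x : Fin p → ℝ)
    (βs : Fin 2 × Fin p → ℝ) {M : Matrix (Fin p) (Fin p) ℝ} (hM : M.PosDef) {ν : ℝ} (hν : 1 < ν)
    {V : Matrix (Fin 2) (Fin 2) ℝ} (hV : V.PosDef) (y : Fin 2 → ℝ) :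
    ∫⁻ θ : (Fin 2 × Fin p → ℝ) × (ℝ × ℝ × ℝ),
        ENNReal.ofReal (likelihood x θ.1 (precisionMatrix θ.2) y *
          normalWishartFactor βs M ν V θ.1 (precisionMatrix θ.2)) =
      ENNReal.ofReal (studentTDensity (ν - 1) ((designMatrix x).mulVec βs)
        (((1 + x ⬝ᵥ M⁻¹.mulVec x) / (ν - 1)) • V⁻¹) y) := by
  have hf : Measurable fun θ : (Fin 2 × Fin p → ℝ) × (ℝ × ℝ × ℝ) =>
      ENNReal.ofReal (likelihood x θ.1 (precisionMatrix θ.2) y *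
        normalWishartFactor βs M ν V θ.1 (precisionMatrix θ.2)) :=
    ((measurable_likelihood x y).mul (measurable_normalWishartFactor βs M ν V)).ennreal_ofReal
  rw [Measure.volume_eq_prod, lintegral_prod_symm' _ hf,
    ← lintegral_normalDensity_mul_wishartDensity hν hV (one_add_dotProduct_inv_pos hM x)]
  refine lintegral_congr fun k => ?_
  by_cases hK : (precisionMatrix k).PosDef
  · have hw : 0 ≤ wishartDensity ν V (precisionMatrix k) :=
      wishartDensity_nonneg (by push_cast; linarith) hV _
    simp_rw [normalWishartFactor, ← mul_assoc, ENNReal.ofReal_mul' hw]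
    rw [lintegral_mul_const' _ _ ENNReal.ofReal_ne_top,
      lintegral_likelihood_mul_normalDensity x βs hM hK y]
  · simp [normalWishartFactor, wishartDensity_of_not_posDef _ _ hK]

theorem lintegral_prod_mul_of_lintegral_eq_one {α β γ : Type*} [MeasureSpace α] [MeasureSpace β]
    [MeasureSpace γ] [SFinite (volume : Measure β)] [SFinite (volume : Measure γ)]
    {f : α × β → ENNReal} {g : γ → ENNReal} (hf : Measurable f) (hg : Measurable g)
    (h : ∫⁻ c, g c = 1) : ∫⁻ z : α × β × γ, f (z.1, z.2.1) * g z.2.2 = ∫⁻ w, f w := by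
  have hfg : Measurable fun z : α × β × γ => f (z.1, z.2.1) * g z.2.2 := by fun_prop
  rw [Measure.volume_eq_prod, lintegral_prod _ hfg.aemeasurable, Measure.volume_eq_prod α β,
    lintegral_prod _ hf.aemeasurable]
  refine lintegral_congr fun a => ?_
  have hfa : Measurable fun z : β × γ => f (a, z.1) * g z.2 := by fun_prop
  rw [Measure.volume_eq_prod β γ, lintegral_prod _ hfa.aemeasurable]
  refine lintegral_congr fun b => ?_
  dsimp only
  rw [lintegral_const_mul _ hg, h, mul_one]

theorem lintegral_likelihood_mul_variationalPosterior {p : ℕ} (x : Fin p → ℝ)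
    (βs : Fin 2 × Fin p → ℝ) (M : Matrix (Fin p) (Fin p) ℝ) {ν : ℝ} (hν : 1 < ν)
    {V : Matrix (Fin 2) (Fin 2) ℝ} (hV : V.PosDef) {c : ℝ} (hc : 0 < c) {d : Fin p → ℝ}
    (hd : ∀ j, 0 < d j) (y : Fin 2 → ℝ) :
    ∫⁻ θ : (Fin 2 × Fin p → ℝ) × (ℝ × ℝ × ℝ) × (Fin p → ℝ),
        ENNReal.ofReal (likelihood x θ.1 (precisionMatrix θ.2.1) y *
          variationalPosterior βs M ν V c d θ.1 (precisionMatrix θ.2.1) θ.2.2) =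
      ∫⁻ θ : (Fin 2 × Fin p → ℝ) × (ℝ × ℝ × ℝ),
        ENNReal.ofReal (likelihood x θ.1 (precisionMatrix θ.2) y *
          normalWishartFactor βs M ν V θ.1 (precisionMatrix θ.2)) := by
  have hf : Measurable fun θ : (Fin 2 × Fin p → ℝ) × (ℝ × ℝ × ℝ) =>
      ENNReal.ofReal (likelihood x θ.1 (precisionMatrix θ.2) y *
        normalWishartFactor βs M ν V θ.1 (precisionMatrix θ.2)) :=
    ((measurable_likelihood x y).mul (measurable_normalWishartFactor βs M ν V)).ennreal_ofReal
  have hg : Measurable fun α : Fin p → ℝ => ENNReal.ofReal (∏ j, gammaPDFReal c (d j) (α j)) := by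
    fun_prop
  have h0 : ∀ θ : (Fin 2 × Fin p → ℝ) × (ℝ × ℝ × ℝ),
      0 ≤ likelihood x θ.1 (precisionMatrix θ.2) y *
        normalWishartFactor βs M ν V θ.1 (precisionMatrix θ.2) := fun θ =>
    mul_nonneg (normalDensity_nonneg _ _ _) (normalWishartFactor_nonneg βs M hν hV _ _)
  have e : ∀ θ : (Fin 2 × Fin p → ℝ) × (ℝ × ℝ × ℝ) × (Fin p → ℝ),
      ENNReal.ofReal (likelihood x θ.1 (precisionMatrix θ.2.1) y *
          variationalPosterior βs M ν V c d θ.1 (precisionMatrix θ.2.1) θ.2.2) =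
        ENNReal.ofReal (likelihood x θ.1 (precisionMatrix θ.2.1) y *
          normalWishartFactor βs M ν V θ.1 (precisionMatrix θ.2.1)) *
        ENNReal.ofReal (∏ j, gammaPDFReal c (d j) (θ.2.2 j)) := fun θ => by
    rw [variationalPosterior, ← mul_assoc, ENNReal.ofReal_mul (h0 (θ.1, θ.2.1))]
  rw [lintegral_congr e]
  exact lintegral_prod_mul_of_lintegral_eq_one hf hg (lintegral_prod_gammaPDFReal hc hd)

end MARD

theorem mainTheorem2 {p : ℕ} (x : Fin p → ℝ)
    (βs : Fin 2 × Fin p → ℝ)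
    (M : Matrix (Fin p) (Fin p) ℝ) (hM : M.PosDef)
    (ν : ℝ) (hν : 1 < ν)
    (V : Matrix (Fin 2) (Fin 2) ℝ) (hV : V.PosDef)
    (c : ℝ) (hc : 0 < c) (d : Fin p → ℝ) (hd : ∀ j, 0 < d j)
    (y : Fin 2 → ℝ) :
    -- the predictive integral over `(β, K, α)` converges
    Integrable (fun θ : (Fin 2 × Fin p → ℝ) × (ℝ × ℝ × ℝ) × (Fin p → ℝ) =>
      MARD.likelihood x θ.1 (MARD.precisionMatrix θ.2.1) y *
        MARD.variationalPosterior βs M ν V c d θ.1 (MARD.precisionMatrix θ.2.1) θ.2.2) ∧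
    -- its value is the bivariate Student t density
    (∫ θ : (Fin 2 × Fin p → ℝ) × (ℝ × ℝ × ℝ) × (Fin p → ℝ),
      MARD.likelihood x θ.1 (MARD.precisionMatrix θ.2.1) y *
        MARD.variationalPosterior βs M ν V c d θ.1 (MARD.precisionMatrix θ.2.1) θ.2.2) =
      MARD.studentTDensity (ν - 1) ((MARD.designMatrix x).mulVec βs)
        (((1 + x ⬝ᵥ M⁻¹.mulVec x) / (ν - 1)) • V⁻¹) y ∧
    -- the same for the integral against the Normal–Wishart factor alone
    Integrable (fun θ : (Fin 2 × Fin p → ℝ) × (ℝ × ℝ × ℝ) =>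
      MARD.likelihood x θ.1 (MARD.precisionMatrix θ.2) y *
        MARD.normalWishartFactor βs M ν V θ.1 (MARD.precisionMatrix θ.2)) ∧
    (∫ θ : (Fin 2 × Fin p → ℝ) × (ℝ × ℝ × ℝ),
      MARD.likelihood x θ.1 (MARD.precisionMatrix θ.2) y *
        MARD.normalWishartFactor βs M ν V θ.1 (MARD.precisionMatrix θ.2)) =
      MARD.studentTDensity (ν - 1) ((MARD.designMatrix x).mulVec βs)
        (((1 + x ⬝ᵥ M⁻¹.mulVec x) / (ν - 1)) • V⁻¹) y ∧
    -- and for the Wishart mixture of normals left after integrating out `β`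
    Integrable (fun k : ℝ × ℝ × ℝ =>
      MARD.normalDensity ((MARD.designMatrix x).mulVec βs)
          ((1 + x ⬝ᵥ M⁻¹.mulVec x)⁻¹ • MARD.precisionMatrix k) y *
        MARD.wishartDensity ν V (MARD.precisionMatrix k)) ∧
    (∫ k : ℝ × ℝ × ℝ,
      MARD.normalDensity ((MARD.designMatrix x).mulVec βs)
          ((1 + x ⬝ᵥ M⁻¹.mulVec x)⁻¹ • MARD.precisionMatrix k) y *
        MARD.wishartDensity ν V (MARD.precisionMatrix k)) =
      MARD.studentTDensity (ν - 1) ((MARD.designMatrix x).mulVec βs)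
        (((1 + x ⬝ᵥ M⁻¹.mulVec x) / (ν - 1)) • V⁻¹) y := by
  have hφ := MARD.one_add_dotProduct_inv_pos hM x
  have hn : 0 < ν - 1 := by linarith
  have ht := MARD.studentTDensity_nonneg hn ((MARD.designMatrix x).mulVec βs)
    (hV.inv.smul (div_pos hφ hn)) y
  have hNW := MARD.lintegral_likelihood_mul_normalWishartFactor x βs hM hν hV y
  have hmL := MARD.measurable_likelihood x y
  have hmNW := MARD.measurable_normalWishartFactor βs M ν V
  have hπ : Measurable fun θ : (Fin 2 × Fin p → ℝ) × (ℝ × ℝ × ℝ) × (Fin p → ℝ) =>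
      (θ.1, θ.2.1) := measurable_fst.prodMk (measurable_fst.comp measurable_snd)
  have hmα : Measurable fun θ : (Fin 2 × Fin p → ℝ) × (ℝ × ℝ × ℝ) × (Fin p → ℝ) =>
      ∏ j, gammaPDFReal c (d j) (θ.2.2 j) := by fun_prop
  have h1 := MARD.integrable_and_integral_eq_of_lintegral
    ((hmL.comp hπ).mul ((hmNW.comp hπ).mul hmα))
    (fun θ => mul_nonneg (MARD.normalDensity_nonneg _ _ _)
      (mul_nonneg (MARD.normalWishartFactor_nonneg βs M hν hV _ _)
        (Finset.prod_nonneg fun j _ => gammaPDFReal_nonneg hc (hd j) _))) ht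
    ((MARD.lintegral_likelihood_mul_variationalPosterior x βs M hν hV hc hd y).trans hNW)
  have h2 := MARD.integrable_and_integral_eq_of_lintegral (hmL.mul hmNW)
    (fun θ => mul_nonneg (MARD.normalDensity_nonneg _ _ _)
      (MARD.normalWishartFactor_nonneg βs M hν hV _ _)) ht hNW
  have h3 := MARD.integrable_and_integral_eq_of_lintegral
    ((MARD.measurable_normalDensity measurable_const measurable_const fun i j =>
      (MARD.measurable_precisionMatrix_apply i j).const_mul _).mul
      (MARD.measurable_wishartDensity_precisionMatrix ν V))
    (fun k => mul_nonneg (MARD.normalDensity_nonneg _ _ _)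
      (MARD.wishartDensity_nonneg (by push_cast; linarith) hV _)) ht
    (MARD.lintegral_normalDensity_mul_wishartDensity hν hV hφ _ y)
  exact ⟨h1.1, h1.2, h2.1, h2.2, h3.1, h3.2⟩
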